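/- Let $R$ be a commutative Noetherian local ring with maximal ideal $\mathfrak m$; all $R$-modules are finitely generated. For a module $M$ and $n\ge 0$, let $\Omega^n M$ be the $n$-th syzygy of $M$ in its minimal free resolution: $\Omega^0M=M$, and $\Omega^{n+1}M$ is the kernel of a surjection $R^{\oplus\mu}\to\Omega^nM$, where $\mu$ is the minimal number of generators of $\Omega^nM$. Write $M^*=\operatorname{Hom}_R(M,R)$. A module $X$ is totally reflexive if the natural map $X\to X^{**}$ is an isomorphism and $\operatorname{Ext}^i_R(X,R)=0=\operatorname{Ext}^i_R(X^*,R)$ for all $i\ge 1$. The Gorenstein dimension $\operatorname{G-dim}_R(M)$ is the infimum of the $n\ge 0$ for which there is an exact sequence $0\to X_n\to\cdots\to X_0\to M\to 0$ with every $X_j$ totally reflexive ($\infty$ if there is none), and $\operatorname{G-dim}_R(0)=-\infty$. **Proposition.** Let $M$ and $K$ be $R$-modules and let $a\ge 1$, $b\ge 1$, $n\ge 0$ be integers. Suppose that there is a short exact sequence of $R$-modules $$0\to M^{\oplus a}\to K\to \Omega^{n}(M^{\oplus b})\to 0$$ with $\operatorname{G-dim}_R(K)<\infty$. Then for each integer $i\ge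 1$ there is a short exact sequence of $R$-modules $$0\to M^{\oplus a_i}\to Y_i\to \Omega^{r_i}(M^{\oplus b_i})\to 0$$ with $\operatorname{G-dim}_R(Y_i)<\infty$, where $r_i=2^i(n+1)-1$, $a_i=a^{2^i}$ and $b_i=b^{2^i}$. -/

import Mathlib

universe u

open CategoryTheory

noncomputable section

/-- The minimal free cover of a module `M`: the free module on a generating set of `M` of smallest
possible cardinality, mapping onto `M`. -/
def minimalCover (R : Type u) [CommRing R] (M : Type u) [AddCommGroup M] [Module R M] :
    ((⊤ : Submodule R M).generators →₀ R) →ₗ[R] M :=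
  Finsupp.linearCombination R (fun x : (⊤ : Submodule R M).generators => (x : M))

/-- The `n`-th syzygy module `Ωⁿ M` in the minimal free resolution of `M`: `Ω⁰ M = M`, and
`Ωⁿ⁺¹ M` is the kernel of the minimal free cover of `Ωⁿ M`. -/
def syzygy (R : Type u) [CommRing R] : ℕ → ModuleCat.{u} R → ModuleCat.{u} R
  | 0, M => M
  | n + 1, M => ModuleCat.of R (LinearMap.ker (minimalCover R (syzygy R n M)))

/-- A totally reflexive module: a finitely generated module `X` which is reflexive and satisfies
`Extⁱ(X, R) = 0 = Extⁱ(X*, R)` for all `i ≥ 1`. -/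
structure IsTotallyReflexive (R : Type u) [CommRing R] (X : Type u) [AddCommGroup X] [Module R X] :
    Prop where
  finite : Module.Finite R X
  reflexive : Module.IsReflexive R X
  ext_eq_zero : ∀ i : ℕ, 1 ≤ i →
    Subsingleton (Abelian.Ext (ModuleCat.of R X) (ModuleCat.of R R) i)
  ext_dual_eq_zero : ∀ i : ℕ, 1 ≤ i →
    Subsingleton (Abelian.Ext (ModuleCat.of R (Module.Dual R X)) (ModuleCat.of R R) i)

/-- There is an exact sequence `0 → Xₙ → ⋯ → X₀ → M → 0` with every `Xᵢ` totally reflexive. The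
sequence is continued to the left by zero modules, so that exactness at `Xₙ` says that
`Xₙ → Xₙ₋₁` (or `X₀ → M` if `n = 0`) is injective. -/
def HasTotallyReflexiveResolution (R : Type u) [CommRing R] (n : ℕ)
    (M : Type u) [AddCommGroup M] [Module R M] : Prop :=
  ∃ (X : ℕ → ModuleCat.{u} R) (d : ∀ i : ℕ, X (i + 1) →ₗ[R] X i) (ε : X 0 →ₗ[R] M),
    (∀ i : ℕ, i ≤ n → IsTotallyReflexive R (X i)) ∧
    (∀ i : ℕ, n < i → Subsingleton (X i)) ∧
    Function.Surjective ε ∧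
    Function.Exact (d 0) ε ∧
    ∀ i : ℕ, Function.Exact (d (i + 1)) (d i)

open Classical in
/-- The Gorenstein dimension of `M`: the infimum of the lengths of the resolutions of `M` by totally
reflexive modules (`⊤` if there is none), with the convention that the zero module has Gorenstein
dimension `-∞`. -/
def gorensteinDim (R : Type u) [CommRing R] (M : Type u) [AddCommGroup M] [Module R M] :
    WithBot ℕ∞ :=
  if Subsingleton M then ⊥
  else ((⨅ (n : ℕ) (_ : HasTotallyReflexiveResolution R n M), (n : ℕ∞) : ℕ∞) : WithBot ℕ∞)

end

/-!
Call a pair `(A, C)` of finitely generated modules *good* if there is a short exact sequence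
`0 → A → Y → C → 0` with `Y` of finite Gorenstein dimension (`HasFiniteGDimExtension`). The theorem
follows by iterating one doubling step (`hasFiniteGDimExtension_double`): if `(Mᵃ, Ωⁿ(Mᵇ))` is good,
then so is `(M^(a²), Ω²ⁿ⁺¹(M^(b²)))`. Under this step `n + 1` doubles, which explains the exponents.

Put `S = Ωⁿ(Mᵇ)`. Taking copies, `((Mᵃ)ᵃ, Sᵃ)` and `((Mᵃ)ᵇ, Sᵇ)` are good, and by the horseshoe lemma
so is `(Ωⁿ⁺¹((Mᵃ)ᵇ), Ωⁿ⁺¹(Sᵇ))`. Up to projective summands its left entry is `Ω(Sᵃ)` and its right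
entry is `Ω²ⁿ⁺¹(M^(b²))`. The sequence `0 → (Mᵃ)ᵃ → Y → Sᵃ → 0` pulls back along the projective cover
of `Sᵃ` to an exact sequence `0 → Ω(Sᵃ) → (Mᵃ)ᵃ ⊕ F → Y → 0` with `F` free; pushing the second
extension out along this embedding makes `(M^(a²), Ω²ⁿ⁺¹(M^(b²)))` good
(`HasFiniteGDimExtension.splice`).

Two facts make this work. Modules of finite Gorenstein dimension have the two-out-of-three property in
short exact sequences (`FiniteGDim.left`, `FiniteGDim.middle`, `FiniteGDim.right`), which reduces to
the closure of totally reflexive modules under extensions and kernels of epimorphisms. And goodness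
depends on `A` and `C` only up to stable isomorphism (`HasFiniteGDimExtension.congr_left`,
`HasFiniteGDimExtension.congr_right`), so Schanuel's lemma replaces all comparisons of minimal
resolutions: the minimality of the covers that define `Ωⁿ` plays no role.
-/

/-! ### Short exact sequences of modules -/

/-- The sequence `0 → A → B → C → 0` given by `f : A → B` and `g : B → C` is exact. -/
structure IsShortExact {R : Type*} [CommRing R] {A B C : Type*} [AddCommGroup A] [AddCommGroup B]
    [AddCommGroup C] [Module R A] [Module R B] [Module R C] (f : A →ₗ[R] B) (g : B →ₗ[R] C) :
    Prop where
  injective : Function.Injective f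
  exact : Function.Exact f g
  surjective : Function.Surjective g

namespace IsShortExact

variable {R : Type*} [CommRing R] {A B C D E F : Type*} [AddCommGroup A] [AddCommGroup B]
  [AddCommGroup C] [AddCommGroup D] [AddCommGroup E] [AddCommGroup F] [Module R A] [Module R B]
  [Module R C] [Module R D] [Module R E] [Module R F]

theorem apply_apply {f : A →ₗ[R] B} {g : B →ₗ[R] C} (h : IsShortExact f g) (x : A) :
    g (f x) = 0 :=
  h.exact.apply_apply_eq_zero x

theorem of_surjective {g : B →ₗ[R] C} (hg : Function.Surjective g) :
    IsShortExact (LinearMap.ker g).subtype g :=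
  ⟨Subtype.val_injective, LinearMap.exact_subtype_ker_map g, hg⟩

theorem of_injective {f : A →ₗ[R] B} (hf : Function.Injective f) :
    IsShortExact f (LinearMap.range f).mkQ :=
  ⟨hf, LinearMap.exact_map_mkQ_range f, Submodule.mkQ_surjective _⟩

/-- The left term may be replaced by an isomorphic module. -/
theorem comp_left {f : A →ₗ[R] B} {g : B →ₗ[R] C} (h : IsShortExact f g) (e : D ≃ₗ[R] A) :
    IsShortExact (f ∘ₗ e.toLinearMap) g where
  injective := h.injective.comp e.injective
  exact x := by
    rw [h.exact x]
    exact ⟨fun ⟨y, hy⟩ => ⟨e.symm y, by simpa using hy⟩, fun ⟨y, hy⟩ => ⟨e y, hy⟩⟩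
  surjective := h.surjective

/-- The right term may be replaced by an isomorphic module. -/
theorem comp_right {f : A →ₗ[R] B} {g : B →ₗ[R] C} (h : IsShortExact f g) (e : C ≃ₗ[R] D) :
    IsShortExact f (e.toLinearMap ∘ₗ g) where
  injective := h.injective
  exact x := by
    rw [← h.exact x]
    simp
  surjective := e.surjective.comp h.surjective

theorem prodMap {f : A →ₗ[R] B} {g : B →ₗ[R] C} (h : IsShortExact f g) {f' : D →ₗ[R] E}
    {g' : E →ₗ[R] F} (h' : IsShortExact f' g') :
    IsShortExact (f.prodMap f') (g.prodMap g') where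
  injective := h.injective.prodMap h'.injective
  exact := by
    rintro ⟨x, y⟩
    have hx := h.exact x
    have hy := h'.exact y
    simp only [LinearMap.prodMap_apply, Prod.mk_eq_zero, hx, hy, Set.mem_range, Prod.exists,
      Prod.mk.injEq]
    exact ⟨fun ⟨⟨a, ha⟩, ⟨b, hb⟩⟩ => ⟨a, b, ha, hb⟩, fun ⟨a, b, ha, hb⟩ => ⟨⟨a, ha⟩, ⟨b, hb⟩⟩⟩
  surjective := h.surjective.prodMap h'.surjective

/-- Copies of a short exact sequence, indexed by an arbitrary type. -/
theorem piMap {f : A →ₗ[R] B} {g : B →ₗ[R] C} (h : IsShortExact f g) (ι : Type*) :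
    IsShortExact (f.compLeft ι) (g.compLeft ι) where
  injective x y hxy := funext fun i => h.injective (congrFun hxy i)
  exact x := by
    have hx : ∀ i, g (x i) = 0 ↔ _ := fun i => h.exact (x i)
    constructor
    · intro h0
      choose y hy using fun i => (hx i).1 (congrFun h0 i)
      exact ⟨y, funext hy⟩
    · rintro ⟨y, rfl⟩
      exact funext fun i => h.apply_apply (y i)
  surjective x := by
    choose y hy using fun i => h.surjective (x i)
    exact ⟨y, funext hy⟩

theorem zero_equiv [Subsingleton D] (e : A ≃ₗ[R] B) :
    IsShortExact (0 : D →ₗ[R] A) e.toLinearMap :=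
  ⟨fun _ _ _ => Subsingleton.elim _ _, fun x => by simp [eq_comm (a := x)], e.surjective⟩

theorem equiv_zero [Subsingleton D] (e : A ≃ₗ[R] B) :
    IsShortExact e.toLinearMap (0 : B →ₗ[R] D) :=
  ⟨e.injective, fun x => by simp [Set.range_eq_univ.2 e.surjective],
    fun _ => ⟨0, Subsingleton.elim _ _⟩⟩

theorem inl_snd : IsShortExact (LinearMap.inl R A B) (LinearMap.snd R A B) :=
  ⟨LinearMap.inl_injective, .inl_snd, LinearMap.snd_surjective⟩

theorem inr_fst : IsShortExact (LinearMap.inr R A B) (LinearMap.fst R A B) :=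
  ⟨LinearMap.inr_injective, .inr_fst, LinearMap.fst_surjective⟩

/-- A short exact sequence ending in a projective module splits. -/
theorem exists_equiv_prod {f : A →ₗ[R] B} {g : B →ₗ[R] C} (h : IsShortExact f g)
    [Module.Projective R C] : Nonempty (B ≃ₗ[R] A × C) := by
  obtain ⟨s, hs⟩ := Module.projective_lifting_property g LinearMap.id h.surjective
  have hs' : ∀ c, g (s c) = c := fun c => LinearMap.congr_fun hs c
  refine ⟨(LinearEquiv.ofBijective (f.coprod s) ⟨?_, fun b => ?_⟩).symm⟩
  · rw [← LinearMap.ker_eq_bot, LinearMap.ker_eq_bot']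
    rintro ⟨a, c⟩ hac
    simp only [LinearMap.coprod_apply] at hac
    have hc : c = 0 := by simpa [h.apply_apply, hs'] using congrArg g hac
    subst hc
    simp only [map_zero, add_zero] at hac
    rw [h.injective (hac.trans (map_zero f).symm)]
    rfl
  · obtain ⟨a, ha⟩ := (h.exact (b - s (g b))).1 (by simp [hs'])
    exact ⟨(a, g b), by simp [ha]⟩

theorem finite_middle {f : A →ₗ[R] B} {g : B →ₗ[R] C} (h : IsShortExact f g)
    [Module.Finite R A] [Module.Finite R C] : Module.Finite R B := by
  have hf : Module.Finite R (LinearMap.ker g) := by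
    rw [h.exact.linearMap_ker_eq]
    infer_instance
  have hr : Module.Finite R (LinearMap.range g) := by
    rw [LinearMap.range_eq_top.2 h.surjective]
    infer_instance
  refine ⟨Submodule.fg_of_fg_map_of_fg_inf_ker g ?_ ?_⟩
  · rw [Submodule.map_top]
    exact Module.Finite.iff_fg.1 hr
  · rw [top_inf_eq]
    exact Module.Finite.iff_fg.1 hf

theorem finite_left [IsNoetherianRing R] {f : A →ₗ[R] B} {g : B →ₗ[R] C} (h : IsShortExact f g)
    [Module.Finite R B] : Module.Finite R A :=
  Module.Finite.of_injective f h.injective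

/-- The pullback of a short exact sequence along `q : D → C`: there are short exact sequences
`0 → A → P → D → 0` and, if `D → C` is onto with kernel `E`, also `0 → E → P → B → 0`. -/
theorem exists_pullback {A B C D E : Type u} [AddCommGroup A] [AddCommGroup B]
    [AddCommGroup C] [AddCommGroup D] [AddCommGroup E] {R : Type u} [CommRing R] [Module R A]
    [Module R B] [Module R C] [Module R D] [Module R E]
    {f : A →ₗ[R] B} {g : B →ₗ[R] C} (h : IsShortExact f g)
    {p : E →ₗ[R] D} {q : D →ₗ[R] C} (h' : IsShortExact p q) :
    ∃ (P : ModuleCat.{u} R) (f₁ : A →ₗ[R] P) (g₁ : P →ₗ[R] D) (p₁ : E →ₗ[R] P) (q₁ : P →ₗ[R] B),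
      IsShortExact f₁ g₁ ∧ IsShortExact p₁ q₁ := by
  let P := LinearMap.ker (g ∘ₗ LinearMap.fst R B D - q ∘ₗ LinearMap.snd R B D)
  have hP : ∀ x : P, g x.1.1 = q x.1.2 := fun x => sub_eq_zero.1 (LinearMap.mem_ker.1 x.2)
  refine ⟨ModuleCat.of R P,
    (LinearMap.inl R B D ∘ₗ f).codRestrict P fun a => by simp [P, h.apply_apply],
    LinearMap.snd R B D ∘ₗ P.subtype,
    (LinearMap.inr R B D ∘ₗ p).codRestrict P fun a => by simp [P, h'.apply_apply],
    LinearMap.fst R B D ∘ₗ P.subtype, ⟨fun x y hxy => ?_, fun x => ⟨fun hx => ?_, ?_⟩, fun d => ?_⟩,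
    ⟨fun x y hxy => ?_, fun x => ⟨fun hx => ?_, ?_⟩, fun b => ?_⟩⟩
  · exact h.injective (congrArg (fun z : P => z.1.1) hxy)
  · have hx2 : x.1.2 = 0 := hx
    obtain ⟨a, ha⟩ := (h.exact x.1.1).1 (by rw [hP x, hx2, map_zero])
    exact ⟨a, Subtype.ext (Prod.ext ha hx2.symm)⟩
  · rintro ⟨a, rfl⟩
    rfl
  · obtain ⟨b, hb⟩ := h.surjective (q d)
    exact ⟨⟨(b, d), by simp [P, hb]⟩, rfl⟩
  · exact h'.injective (congrArg (fun z : P => z.1.2) hxy)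
  · have hx1 : x.1.1 = 0 := hx
    obtain ⟨a, ha⟩ := (h'.exact x.1.2).1 (by rw [← hP x, hx1, map_zero])
    exact ⟨a, Subtype.ext (Prod.ext hx1.symm ha)⟩
  · rintro ⟨a, rfl⟩
    rfl
  · obtain ⟨d, hd⟩ := h'.surjective (g b)
    exact ⟨⟨(b, d), by simp [P, hd]⟩, rfl⟩

/-- The pushout of a short exact sequence along the monomorphism `p : A → D`: there are short exact
sequences `0 → D → Q → C → 0` and `0 → B → Q → E → 0`, where `E` is the cokernel of `p`. -/
theorem exists_pushout {A B C D E : Type u} [AddCommGroup A] [AddCommGroup B]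
    [AddCommGroup C] [AddCommGroup D] [AddCommGroup E] {R : Type u} [CommRing R] [Module R A]
    [Module R B] [Module R C] [Module R D] [Module R E]
    {f : A →ₗ[R] B} {g : B →ₗ[R] C} (h : IsShortExact f g)
    {p : A →ₗ[R] D} {q : D →ₗ[R] E} (h' : IsShortExact p q) :
    ∃ (Q : ModuleCat.{u} R) (f₁ : D →ₗ[R] Q) (g₁ : Q →ₗ[R] C) (p₁ : B →ₗ[R] Q) (q₁ : Q →ₗ[R] E),
      IsShortExact f₁ g₁ ∧ IsShortExact p₁ q₁ := by
  let N := LinearMap.range (f.prod (-p))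
  have hgN : N ≤ LinearMap.ker (g ∘ₗ LinearMap.fst R B D) := by
    rintro _ ⟨a, rfl⟩
    simp [h.apply_apply]
  have hqN : N ≤ LinearMap.ker (q ∘ₗ LinearMap.snd R B D) := by
    rintro _ ⟨a, rfl⟩
    simp [h'.apply_apply]
  refine ⟨ModuleCat.of R ((B × D) ⧸ N), N.mkQ ∘ₗ LinearMap.inr R B D, N.liftQ _ hgN,
    N.mkQ ∘ₗ LinearMap.inl R B D, N.liftQ _ hqN, ⟨?_, fun x => ⟨?_, ?_⟩, fun c => ?_⟩,
    ⟨?_, fun x => ⟨?_, ?_⟩, fun e => ?_⟩⟩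
  · rw [← LinearMap.ker_eq_bot, LinearMap.ker_eq_bot']
    intro d hd
    obtain ⟨a, ha⟩ := (Submodule.Quotient.mk_eq_zero N).1 hd
    have h1 : f a = 0 := congrArg Prod.fst ha
    have h2 : -p a = d := congrArg Prod.snd ha
    rw [← h2, h.injective (h1.trans (map_zero f).symm), map_zero, neg_zero]
  · obtain ⟨⟨b, d⟩, rfl⟩ := N.mkQ_surjective x
    intro hx
    obtain ⟨a, rfl⟩ := (h.exact b).1 hx
    refine ⟨d + p a, (Submodule.Quotient.eq N).2 ⟨-a, ?_⟩⟩
    simp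
  · rintro ⟨d, rfl⟩
    exact map_zero g
  · obtain ⟨b, rfl⟩ := h.surjective c
    exact ⟨N.mkQ (b, 0), rfl⟩
  · rw [← LinearMap.ker_eq_bot, LinearMap.ker_eq_bot']
    intro d hd
    obtain ⟨a, ha⟩ := (Submodule.Quotient.mk_eq_zero N).1 hd
    have h1 : f a = d := congrArg Prod.fst ha
    have h2 : -p a = 0 := congrArg Prod.snd ha
    rw [← h1, h'.injective ((neg_eq_zero.1 h2).trans (map_zero p).symm), map_zero]
  · obtain ⟨⟨b, d⟩, rfl⟩ := N.mkQ_surjective x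
    intro hx
    obtain ⟨a, rfl⟩ := (h'.exact d).1 hx
    refine ⟨b + f a, (Submodule.Quotient.eq N).2 ⟨a, ?_⟩⟩
    simp
  · rintro ⟨d, rfl⟩
    exact map_zero q
  · obtain ⟨b, rfl⟩ := h'.surjective e
    exact ⟨N.mkQ (0, b), rfl⟩

/-- The kernels of two composable epimorphisms and of their composition form a short exact
sequence. -/
theorem exists_ker_comp {A B C D E : Type u} [AddCommGroup A] [AddCommGroup B]
    [AddCommGroup C] [AddCommGroup D] [AddCommGroup E] {R : Type u} [CommRing R] [Module R A]
    [Module R B] [Module R C] [Module R D] [Module R E]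
    {f : A →ₗ[R] B} {g : B →ₗ[R] C} (h : IsShortExact f g)
    {p : D →ₗ[R] C} {q : C →ₗ[R] E} (h' : IsShortExact p q) :
    ∃ (Q : ModuleCat.{u} R) (i : A →ₗ[R] Q) (s : Q →ₗ[R] D) (j : Q →ₗ[R] B),
      IsShortExact i s ∧ IsShortExact j (q ∘ₗ g) := by
  let Q := LinearMap.ker (q ∘ₗ g)
  let e := LinearEquiv.ofInjective p h'.injective
  have he : ∀ y, p (e.symm y) = y := fun y => congrArg Subtype.val (e.apply_symm_apply y)
  have hgQ : ∀ x : Q, (g ∘ₗ Q.subtype) x ∈ LinearMap.range p := fun x => (h'.exact _).1 x.2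
  have hs := h'.surjective.comp h.surjective
  refine ⟨ModuleCat.of R Q, f.codRestrict Q fun a => by simp [Q, h.apply_apply],
    e.symm.toLinearMap ∘ₗ (g ∘ₗ Q.subtype).codRestrict _ hgQ, Q.subtype,
    ⟨fun x y hxy => h.injective (congrArg Subtype.val hxy), fun x => ?_, fun d => ?_⟩,
    of_surjective hs⟩
  · have h1 : (e.symm.toLinearMap ∘ₗ (g ∘ₗ Q.subtype).codRestrict _ hgQ) x = 0 ↔ g x.1 = 0 := by
      rw [LinearMap.comp_apply, LinearEquiv.coe_coe, LinearEquiv.map_eq_zero_iff]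
      exact Subtype.ext_iff
    rw [h1, h.exact x.1]
    exact ⟨fun ⟨a, ha⟩ => ⟨a, Subtype.ext ha⟩, fun ⟨a, ha⟩ => ⟨a, congrArg Subtype.val ha⟩⟩
  · obtain ⟨b, hb⟩ := h.surjective (p d)
    refine ⟨⟨b, by simp [Q, hb, h'.apply_apply]⟩, h'.injective ?_⟩
    exact (he _).trans hb

/-- The cokernels of two composable monomorphisms and of their composition form a short exact
sequence. -/
theorem exists_coker_comp {A B C D E : Type u} [AddCommGroup A] [AddCommGroup B]
    [AddCommGroup C] [AddCommGroup D] [AddCommGroup E] {R : Type u} [CommRing R] [Module R A]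
    [Module R B] [Module R C] [Module R D] [Module R E]
    {f : A →ₗ[R] B} {g : B →ₗ[R] C} (h : IsShortExact f g)
    {p : D →ₗ[R] A} {q : A →ₗ[R] E} (h' : IsShortExact p q) :
    ∃ (Q : ModuleCat.{u} R) (i : E →ₗ[R] Q) (s : Q →ₗ[R] C) (t : B →ₗ[R] Q),
      IsShortExact i s ∧ IsShortExact (f ∘ₗ p) t := by
  let N := LinearMap.range (f ∘ₗ p)
  have hgN : N ≤ LinearMap.ker g := by
    rintro _ ⟨d, rfl⟩
    exact h.apply_apply _
  have hqN : LinearMap.ker q ≤ LinearMap.ker (N.mkQ ∘ₗ f) := by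
    intro a ha
    obtain ⟨d, rfl⟩ := (h'.exact a).1 ha
    exact (Submodule.Quotient.mk_eq_zero N).2 ⟨d, rfl⟩
  let i : E →ₗ[R] B ⧸ N := (LinearMap.ker q).liftQ _ hqN ∘ₗ
    (q.quotKerEquivOfSurjective h'.surjective).symm.toLinearMap
  have hi : ∀ a, i (q a) = N.mkQ (f a) := fun a => by
    have : (q.quotKerEquivOfSurjective h'.surjective).symm (q a) = Submodule.Quotient.mk a := by
      rw [LinearEquiv.symm_apply_eq]
      rfl
    simp [i, this]
  refine ⟨ModuleCat.of R (B ⧸ N), i, N.liftQ g hgN, N.mkQ, ⟨?_, fun x => ⟨?_, ?_⟩, fun c => ?_⟩,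
    of_injective (h.injective.comp h'.injective)⟩
  · rw [← LinearMap.ker_eq_bot, LinearMap.ker_eq_bot']
    intro e he
    obtain ⟨a, rfl⟩ := h'.surjective e
    obtain ⟨d, hd⟩ := (Submodule.Quotient.mk_eq_zero N).1 ((hi a).symm.trans he)
    rw [← h.injective hd, h'.apply_apply]
  · obtain ⟨b, rfl⟩ := N.mkQ_surjective x
    intro hx
    obtain ⟨a, rfl⟩ := (h.exact b).1 hx
    exact ⟨q a, hi a⟩
  · rintro ⟨e, rfl⟩
    obtain ⟨a, rfl⟩ := h'.surjective e
    rw [hi]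
    exact h.apply_apply a
  · obtain ⟨b, rfl⟩ := h.surjective c
    exact ⟨N.mkQ b, rfl⟩

/-- The horseshoe lemma, for one step of a resolution: presentations of `A` and `C` combine to a
presentation of `B` whose kernel is an extension of the given kernels. -/
theorem exists_horseshoe {A B C D E P Q : Type u} [AddCommGroup A] [AddCommGroup B]
    [AddCommGroup C] [AddCommGroup D] [AddCommGroup E] [AddCommGroup P] [AddCommGroup Q]
    {R : Type u} [CommRing R] [Module R A] [Module R B] [Module R C] [Module R D] [Module R E]
    [Module R P] [Module R Q] [Module.Projective R Q]
    {f : A →ₗ[R] B} {g : B →ₗ[R] C} (h : IsShortExact f g)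
    {i : D →ₗ[R] P} {p : P →ₗ[R] A} (hA : IsShortExact i p)
    {j : E →ₗ[R] Q} {q : Q →ₗ[R] C} (hC : IsShortExact j q) :
    ∃ (Z : ModuleCat.{u} R) (f' : D →ₗ[R] Z) (g' : Z →ₗ[R] E) (k : Z →ₗ[R] P × Q)
      (r : P × Q →ₗ[R] B), IsShortExact f' g' ∧ IsShortExact k r := by
  obtain ⟨X, f₁, g₁, p₁, q₁, h₁, h₂⟩ := h.exists_pullback hC
  obtain ⟨e⟩ := h₁.exists_equiv_prod
  have h₃ := ((hA.prodMap (zero_equiv (D := PUnit.{u + 1}) (.refl R Q))).comp_left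
    LinearEquiv.prodUnique.symm).comp_right e.symm
  obtain ⟨Z, f', g', k, h₄, h₅⟩ := h₃.exists_ker_comp h₂
  exact ⟨Z, f', g', k, _, h₄, h₅⟩

end IsShortExact

/-! ### Vanishing of `Ext` and short exact sequences -/

namespace IsShortExact

open Abelian

variable {R : Type u} [CommRing R] {A B C : Type u} [AddCommGroup A] [AddCommGroup B]
  [AddCommGroup C] [Module R A] [Module R B] [Module R C] {f : A →ₗ[R] B} {g : B →ₗ[R] C}

/-- The short exact sequence as a short complex in the category of modules. -/
theorem shortExact (h : IsShortExact f g) :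
    (ShortComplex.mk (ModuleCat.ofHom f) (ModuleCat.ofHom g)
      (by ext x; exact h.apply_apply x)).ShortExact :=
  ModuleCat.shortComplex_shortExact _ h.exact h.injective h.surjective

theorem subsingleton_ext_middle (h : IsShortExact f g) (Y : ModuleCat.{u} R) (i : ℕ)
    (hA : Subsingleton (Ext (ModuleCat.of R A) Y i))
    (hC : Subsingleton (Ext (ModuleCat.of R C) Y i)) :
    Subsingleton (Ext (ModuleCat.of R B) Y i) := by
  refine subsingleton_of_forall_eq 0 fun x => ?_
  obtain ⟨y, rfl⟩ := Ext.contravariant_sequence_exact₂ h.shortExact Y x (hA.elim _ _)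
  rw [hC.elim y 0]
  exact Ext.comp_zero ..

theorem subsingleton_ext_left (h : IsShortExact f g) (Y : ModuleCat.{u} R) (i : ℕ)
    (hB : Subsingleton (Ext (ModuleCat.of R B) Y i))
    (hC : Subsingleton (Ext (ModuleCat.of R C) Y (i + 1))) :
    Subsingleton (Ext (ModuleCat.of R A) Y i) := by
  refine subsingleton_of_forall_eq 0 fun x => ?_
  obtain ⟨y, rfl⟩ := Ext.contravariant_sequence_exact₁ h.shortExact Y x (add_comm 1 i)
    (hC.elim _ _)
  rw [hB.elim y 0]
  exact Ext.comp_zero ..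

/-- If `Ext¹(C, Y) = 0`, then homomorphisms `A → Y` extend to `B`. -/
theorem exists_extension (h : IsShortExact f g) {Y : Type u} [AddCommGroup Y] [Module R Y]
    (hC : Subsingleton (Ext (ModuleCat.of R C) (ModuleCat.of R Y) 1)) (φ : A →ₗ[R] Y) :
    ∃ ψ : B →ₗ[R] Y, ψ ∘ₗ f = φ := by
  obtain ⟨y, hy⟩ := Ext.contravariant_sequence_exact₁ h.shortExact (ModuleCat.of R Y)
    (Ext.mk₀ (ModuleCat.ofHom φ)) (add_zero 1) (hC.elim _ _)
  obtain ⟨ψ, rfl⟩ := Ext.addEquiv₀.symm.surjective y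
  refine ⟨ψ.hom, ?_⟩
  rw [Ext.addEquiv₀_symm_apply, Ext.mk₀_comp_mk₀] at hy
  have := (Ext.mk₀_bijective _ _).injective hy
  exact congrArg ModuleCat.Hom.hom this

/-- If `Ext¹(B, Y) = 0` and homomorphisms `A → Y` extend to `B`, then `Ext¹(C, Y) = 0`. -/
theorem subsingleton_ext_one_right (h : IsShortExact f g) {Y : Type u} [AddCommGroup Y]
    [Module R Y] (hB : Subsingleton (Ext (ModuleCat.of R B) (ModuleCat.of R Y) 1))
    (hext : ∀ φ : A →ₗ[R] Y, ∃ ψ : B →ₗ[R] Y, ψ ∘ₗ f = φ) :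
    Subsingleton (Ext (ModuleCat.of R C) (ModuleCat.of R Y) 1) := by
  refine subsingleton_of_forall_eq 0 fun x => ?_
  obtain ⟨y, rfl⟩ := Ext.contravariant_sequence_exact₃ h.shortExact (ModuleCat.of R Y) x
    (hB.elim _ _) (add_zero 1)
  obtain ⟨φ, rfl⟩ := Ext.addEquiv₀.symm.surjective y
  obtain ⟨ψ, hψ⟩ := hext φ.hom
  have hφ : φ = ModuleCat.ofHom f ≫ ModuleCat.ofHom ψ := by
    ext x
    exact (LinearMap.congr_fun hψ x).symm
  rw [Ext.addEquiv₀_symm_apply, hφ, ← Ext.mk₀_comp_mk₀]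
  exact h.shortExact.extClass_comp_assoc _

/-- If `Ext¹(C, R) = 0`, then the dual of `0 → A → B → C → 0` is exact. -/
theorem dualMap (h : IsShortExact f g)
    (hC : Subsingleton (Ext (ModuleCat.of R C) (ModuleCat.of R R) 1)) :
    IsShortExact g.dualMap f.dualMap where
  injective := LinearMap.dualMap_injective_of_surjective h.surjective
  exact φ := by
    constructor
    · intro hφ
      have hle : LinearMap.ker g ≤ LinearMap.ker φ := by
        rw [h.exact.linearMap_ker_eq]
        rintro _ ⟨a, rfl⟩
        exact LinearMap.congr_fun hφ a
      refine ⟨(LinearMap.ker g).liftQ φ hle ∘ₗ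
        (g.quotKerEquivOfSurjective h.surjective).symm.toLinearMap, ?_⟩
      ext b
      have : (g.quotKerEquivOfSurjective h.surjective).symm (g b) = Submodule.Quotient.mk b := by
        rw [LinearEquiv.symm_apply_eq]
        rfl
      simp [this]
    · rintro ⟨ψ, rfl⟩
      ext a
      simp [h.apply_apply]
  surjective φ := h.exists_extension hC φ

theorem bijective_middle {A' B' C' : Type*} [AddCommGroup A'] [AddCommGroup B'] [AddCommGroup C']
    [Module R A'] [Module R B'] [Module R C'] {f' : A' →ₗ[R] B'} {g' : B' →ₗ[R] C'}
    (h : IsShortExact f g) (h' : IsShortExact f' g') {α : A →ₗ[R] A'} {β : B →ₗ[R] B'}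
    {γ : C →ₗ[R] C'} (hf : f' ∘ₗ α = β ∘ₗ f) (hg : g' ∘ₗ β = γ ∘ₗ g)
    (hα : Function.Bijective α) (hγ : Function.Bijective γ) : Function.Bijective β := by
  have hf a : f' (α a) = β (f a) := LinearMap.congr_fun hf a
  have hg b : g' (β b) = γ (g b) := LinearMap.congr_fun hg b
  constructor
  · rw [← LinearMap.ker_eq_bot, LinearMap.ker_eq_bot']
    intro b hb
    obtain ⟨a, rfl⟩ := (h.exact b).1 (hγ.1 (by rw [← hg, hb, map_zero, map_zero]))
    have ha : α a = 0 := h'.injective (by rw [hf, hb, map_zero])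
    rw [hα.1 (ha.trans (map_zero α).symm), map_zero]
  · intro b'
    obtain ⟨c, hc⟩ := hγ.2 (g' b')
    obtain ⟨b, rfl⟩ := h.surjective c
    obtain ⟨a', ha'⟩ := (h'.exact (b' - β b)).1 (by rw [map_sub, hg, hc, sub_self])
    obtain ⟨a, rfl⟩ := hα.2 a'
    exact ⟨b + f a, by rw [map_add, ← hf, ha', add_sub_cancel]⟩

theorem bijective_left {A' B' C' : Type*} [AddCommGroup A'] [AddCommGroup B'] [AddCommGroup C']
    [Module R A'] [Module R B'] [Module R C'] {f' : A' →ₗ[R] B'} {g' : B' →ₗ[R] C'}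
    (h : IsShortExact f g) (h' : IsShortExact f' g') {α : A →ₗ[R] A'} {β : B →ₗ[R] B'}
    {γ : C →ₗ[R] C'} (hf : f' ∘ₗ α = β ∘ₗ f) (hg : g' ∘ₗ β = γ ∘ₗ g)
    (hβ : Function.Bijective β) (hγ : Function.Bijective γ) : Function.Bijective α := by
  have hf a : f' (α a) = β (f a) := LinearMap.congr_fun hf a
  have hg b : g' (β b) = γ (g b) := LinearMap.congr_fun hg b
  constructor
  · intro a₁ a₂ ha
    exact h.injective (hβ.1 (by rw [← hf, ← hf, ha]))
  · intro a'
    obtain ⟨b, hb⟩ := hβ.2 (f' a')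
    obtain ⟨a, rfl⟩ := (h.exact b).1 (hγ.1 (by rw [← hg, hb, h'.apply_apply, map_zero]))
    exact ⟨a, h'.injective (by rw [hf, hb])⟩

end IsShortExact

/-! ### Totally reflexive modules -/

namespace IsTotallyReflexive

open Module

variable {R : Type u} [CommRing R] {A B C : Type u} [AddCommGroup A] [AddCommGroup B]
  [AddCommGroup C] [Module R A] [Module R B] [Module R C] {f : A →ₗ[R] B} {g : B →ₗ[R] C}

theorem of_projective (P : Type u) [AddCommGroup P] [Module R P] [Module.Finite R P]
    [Projective R P] : IsTotallyReflexive R P where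
  finite := inferInstance
  reflexive := inferInstance
  ext_eq_zero i hi := by
    obtain ⟨i, rfl⟩ := Nat.exists_eq_add_of_le' hi
    have := (IsProjective.iff_projective (ModuleCat.of R P)).1 ‹_›
    exact Abelian.Ext.subsingleton_of_projective _ _ _
  ext_dual_eq_zero i hi := by
    obtain ⟨i, rfl⟩ := Nat.exists_eq_add_of_le' hi
    have hP : Projective R (Dual R P) := inferInstance
    have := (IsProjective.iff_projective (ModuleCat.of R (Dual R P))).1 hP
    exact Abelian.Ext.subsingleton_of_projective _ _ _

theorem of_subsingleton (P : Type u) [AddCommGroup P] [Module R P] [Subsingleton P] :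
    IsTotallyReflexive R P :=
  of_projective P

/-- An extension of totally reflexive modules is totally reflexive. -/
theorem middle (h : IsShortExact f g) (hA : IsTotallyReflexive R A)
    (hC : IsTotallyReflexive R C) : IsTotallyReflexive R B where
  finite :=
    have := hA.finite
    have := hC.finite
    h.finite_middle
  reflexive := ⟨h.bijective_middle
    ((h.dualMap (hC.ext_eq_zero 1 le_rfl)).dualMap (hA.ext_dual_eq_zero 1 le_rfl))
    rfl rfl hA.reflexive.1 hC.reflexive.1⟩
  ext_eq_zero i hi := h.subsingleton_ext_middle _ i (hA.ext_eq_zero i hi) (hC.ext_eq_zero i hi)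
  ext_dual_eq_zero i hi := (h.dualMap (hC.ext_eq_zero 1 le_rfl)).subsingleton_ext_middle _ i
    (hC.ext_dual_eq_zero i hi) (hA.ext_dual_eq_zero i hi)

/-- The kernel of an epimorphism between totally reflexive modules is totally reflexive. -/
theorem left [IsNoetherianRing R] (h : IsShortExact f g) (hB : IsTotallyReflexive R B)
    (hC : IsTotallyReflexive R C) : IsTotallyReflexive R A := by
  have hd := h.dualMap (hC.ext_eq_zero 1 le_rfl)
  -- In degree one the vanishing of `Ext¹(A*, R)` amounts to surjectivity of `B** → C**`, which
  -- by reflexivity is the given map `B → C`.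
  have hd1 : Subsingleton (Abelian.Ext (ModuleCat.of R (Dual R A)) (ModuleCat.of R R) 1) := by
    refine hd.subsingleton_ext_one_right (hB.ext_dual_eq_zero 1 le_rfl) fun φ => ?_
    obtain ⟨c, rfl⟩ := hC.reflexive.1.2 φ
    obtain ⟨b, rfl⟩ := h.surjective c
    exact ⟨Dual.eval R B b, rfl⟩
  refine ⟨?_, ⟨h.bijective_left (hd.dualMap hd1) rfl rfl hB.reflexive.1 hC.reflexive.1⟩,
    fun i hi => h.subsingleton_ext_left _ i (hB.ext_eq_zero i hi)
      (hC.ext_eq_zero _ (Nat.le_add_left 1 i)), fun i hi => ?_⟩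
  · have := hB.finite
    exact h.finite_left
  · obtain rfl | hi := hi.eq_or_lt
    · exact hd1
    · obtain ⟨i, rfl⟩ := Nat.exists_eq_add_of_lt hi
      refine subsingleton_of_forall_eq 0 fun x => ?_
      obtain ⟨y, rfl⟩ := Abelian.Ext.contravariant_sequence_exact₃ hd.shortExact
        (ModuleCat.of R R) x ((hB.ext_dual_eq_zero _ (by lia)).elim _ _)
        (n₀ := 1 + i) (by lia)
      rw [(hC.ext_dual_eq_zero (1 + i) (by lia)).elim y 0]
      exact Abelian.Ext.comp_zero ..

theorem congr (e : A ≃ₗ[R] B) (hB : IsTotallyReflexive R B) : IsTotallyReflexive R A :=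
  middle (.zero_equiv e) (of_subsingleton PUnit.{u + 1}) hB

end IsTotallyReflexive

/-! ### Modules of finite Gorenstein dimension -/

section

variable (R : Type u) [CommRing R]

/-- `M` has a resolution of length at most `n` by totally reflexive modules, in recursive form:
either `n = 0` and `M` is totally reflexive, or there is a short exact sequence
`0 → A → T → M → 0` with `T` totally reflexive and `A` having a resolution of length `n - 1`. -/
def GDimLE : ℕ → ∀ (M : Type u) [AddCommGroup M] [Module R M], Prop
  | 0, M, _, _ => IsTotallyReflexive R M
  | n + 1, M, _, _ => ∃ (A T : ModuleCat.{u} R) (f : A →ₗ[R] T) (g : T →ₗ[R] M),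
      IsShortExact f g ∧ IsTotallyReflexive R T ∧ GDimLE n A

/-- `M` has a finite resolution by totally reflexive modules. The zero module is included. -/
def FiniteGDim (M : Type u) [AddCommGroup M] [Module R M] : Prop :=
  ∃ n, GDimLE R n M

end

section

variable {R : Type u} [CommRing R] {A B C : Type u} [AddCommGroup A] [AddCommGroup B]
  [AddCommGroup C] [Module R A] [Module R B] [Module R C] {f : A →ₗ[R] B} {g : B →ₗ[R] C}

namespace GDimLE

theorem succ {n : ℕ} (h : GDimLE R n A) : GDimLE R (n + 1) A := by
  induction n generalizing A with
  | zero => exact ⟨ModuleCat.of R PUnit, ModuleCat.of R A, 0, _, .zero_equiv (.refl R A), h,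
      .of_subsingleton PUnit⟩
  | succ n ih =>
    obtain ⟨X, T, i, p, hip, hT, hX⟩ := h
    exact ⟨X, T, i, p, hip, hT, ih hX⟩

theorem mono {m n : ℕ} (hmn : m ≤ n) (h : GDimLE R m A) : GDimLE R n A :=
  Nat.le_induction h (fun _ _ => succ) n hmn

theorem congr {n : ℕ} (h : GDimLE R n A) (e : A ≃ₗ[R] B) : GDimLE R n B := by
  cases n with
  | zero => exact IsTotallyReflexive.congr e.symm h
  | succ n =>
    obtain ⟨X, T, i, p, hip, hT, hX⟩ := h
    exact ⟨X, T, i, _, hip.comp_right e, hT, hX⟩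

theorem finite {n : ℕ} (h : GDimLE R n A) : Module.Finite R A := by
  cases n with
  | zero => exact IsTotallyReflexive.finite h
  | succ n =>
    obtain ⟨X, T, i, p, hip, hT, hX⟩ := h
    have := hT.finite
    exact Module.Finite.of_surjective p hip.surjective

theorem prod_projective {n : ℕ} (h : GDimLE R n A) (P : Type u) [AddCommGroup P] [Module R P]
    [Module.Finite R P] [Module.Projective R P] : GDimLE R n (A × P) := by
  cases n with
  | zero => exact IsTotallyReflexive.middle .inl_snd h (.of_projective P)
  | succ n =>
    obtain ⟨X, T, i, p, hip, hT, hX⟩ := h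
    exact ⟨X, ModuleCat.of R (T × P), _, _,
      (hip.prodMap (.zero_equiv (D := PUnit.{u + 1}) (.refl R P))).comp_left
        LinearEquiv.prodUnique.symm, .middle .inl_snd hT (.of_projective P), hX⟩

variable [IsNoetherianRing R]

theorem left_of_isTotallyReflexive {n : ℕ} (h : IsShortExact f g) (hB : GDimLE R n B)
    (hC : IsTotallyReflexive R C) : GDimLE R n A := by
  cases n with
  | zero => exact IsTotallyReflexive.left h hB hC
  | succ n =>
    obtain ⟨X, T, i, p, hip, hT, hX⟩ := hB
    obtain ⟨Q, i', s, j, h₁, h₂⟩ := hip.exists_ker_comp h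
    exact ⟨X, Q, i', s, h₁, .left h₂ hT hC, hX⟩

/-- The bound drops by one on passing to the kernel of any finitely generated projective cover,
not only of the totally reflexive cover that witnesses the bound. -/
theorem left_of_projective {n : ℕ} (h : IsShortExact f g) [Module.Finite R B]
    [Module.Projective R B] (hC : GDimLE R (n + 1) C) : GDimLE R n A := by
  obtain ⟨X, T, i, p, hip, hT, hX⟩ := hC
  obtain ⟨P, f₁, g₁, p₁, q₁, h₁, h₂⟩ := hip.exists_pullback h
  obtain ⟨e⟩ := h₁.exists_equiv_prod
  exact left_of_isTotallyReflexive h₂ ((hX.prod_projective B).congr e.symm) hT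

end GDimLE

/-- A finitely generated module is a quotient of a finitely generated free module. -/
theorem exists_isShortExact_projective (R : Type u) [CommRing R] (M : Type u) [AddCommGroup M]
    [Module R M] [Module.Finite R M] : ∃ (Z P : ModuleCat.{u} R) (i : Z →ₗ[R] P) (p : P →ₗ[R] M),
      IsShortExact i p ∧ Module.Finite R P ∧ Module.Projective R P := by
  obtain ⟨n, p, hp⟩ := Module.Finite.exists_fin' R M
  exact ⟨ModuleCat.of R (LinearMap.ker p), ModuleCat.of R (Fin n → R), _, p, .of_surjective hp,
    inferInstanceAs (Module.Finite R (Fin n → R)),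
    inferInstanceAs (Module.Projective R (Fin n → R))⟩

theorem GDimLE.middle [IsNoetherianRing R] {n : ℕ} (h : IsShortExact f g) (hA : GDimLE R n A)
    (hC : GDimLE R n C) : GDimLE R n B := by
  induction n generalizing A B C with
  | zero => exact IsTotallyReflexive.middle h hA hC
  | succ n ih =>
    have := hA.finite
    have := hC.finite
    obtain ⟨X, P, i, p, hip, _, _⟩ := exists_isShortExact_projective R A
    obtain ⟨Y, Q, j, q, hjq, _, _⟩ := exists_isShortExact_projective R C
    obtain ⟨Z, f', g', k, r, h₁, h₂⟩ := h.exists_horseshoe hip hjq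
    exact ⟨Z, ModuleCat.of R (P × Q), k, r, h₂, .of_projective (P × Q),
      ih h₁ (left_of_projective hip hA) (left_of_projective hjq hC)⟩

namespace FiniteGDim

theorem of_projective (P : Type u) [AddCommGroup P] [Module R P] [Module.Finite R P]
    [Module.Projective R P] : FiniteGDim R P :=
  ⟨0, IsTotallyReflexive.of_projective P⟩

theorem finite (h : FiniteGDim R A) : Module.Finite R A :=
  h.elim fun _ => GDimLE.finite

theorem congr (h : FiniteGDim R A) (e : A ≃ₗ[R] B) : FiniteGDim R B :=
  h.imp fun _ hn => hn.congr e

variable [IsNoetherianRing R]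

theorem middle (h : IsShortExact f g) (hA : FiniteGDim R A) (hC : FiniteGDim R C) :
    FiniteGDim R B := by
  obtain ⟨m, hA⟩ := hA
  obtain ⟨n, hC⟩ := hC
  exact ⟨max m n, .middle h (hA.mono (le_max_left m n)) (hC.mono (le_max_right m n))⟩

theorem left (h : IsShortExact f g) (hB : FiniteGDim R B) (hC : FiniteGDim R C) :
    FiniteGDim R A := by
  obtain ⟨n | n, hC⟩ := hC
  · exact hB.imp fun _ hn => .left_of_isTotallyReflexive h hn hC
  · obtain ⟨X, T, i, p, hip, hT, hX⟩ := hC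
    obtain ⟨P, f₁, g₁, p₁, q₁, h₁, h₂⟩ := h.exists_pullback hip
    exact (middle h₂ ⟨n, hX⟩ hB).imp fun _ hn => .left_of_isTotallyReflexive h₁ hn hT

theorem right (h : IsShortExact f g) (hA : FiniteGDim R A) (hB : FiniteGDim R B) :
    FiniteGDim R C := by
  obtain ⟨n, hB⟩ := hB
  obtain ⟨X, T, i, p, hip, hT, hX⟩ := hB.succ
  obtain ⟨Q, i', s, j, h₁, h₂⟩ := hip.exists_ker_comp h
  obtain ⟨m, hQ⟩ := middle h₁ ⟨n, hX⟩ hA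
  exact ⟨m + 1, Q, T, _, _, h₂, hT, hQ⟩

theorem prod (hA : FiniteGDim R A) (hB : FiniteGDim R B) : FiniteGDim R (A × B) :=
  middle .inl_snd hA hB

theorem pi (hA : FiniteGDim R A) (c : ℕ) : FiniteGDim R (Fin c → A) := by
  induction c with
  | zero => exact ⟨0, IsTotallyReflexive.of_subsingleton _⟩
  | succ c ih => exact (hA.prod ih).congr (Fin.consLinearEquiv R fun _ => A)

end FiniteGDim

/-! ### Comparison with the Gorenstein dimension -/

theorem HasTotallyReflexiveResolution.gDimLE {n : ℕ} (h : HasTotallyReflexiveResolution R n A) :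
    GDimLE R n A := by
  induction n generalizing A with
  | zero =>
    obtain ⟨X, d, ε, hT, hX, hε, hdε, hd⟩ := h
    have := hX 1 one_pos
    have hinj : Function.Injective ε := by
      rw [← LinearMap.ker_eq_bot, hdε.linearMap_ker_eq, LinearMap.range_eq_bot]
      exact Subsingleton.elim _ _
    exact (hT 0 le_rfl).congr (LinearEquiv.ofBijective ε ⟨hinj, hε⟩).symm
  | succ n ih =>
    obtain ⟨X, d, ε, hT, hX, hε, hdε, hd⟩ := h
    refine ⟨ModuleCat.of R (LinearMap.ker ε), X 0, _, ε, .of_surjective hε, hT 0 (Nat.zero_le _),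
      ih ⟨fun i => X (i + 1), fun i => d (i + 1),
        (d 0).codRestrict _ fun x => hdε.apply_apply_eq_zero x, fun i hi => hT _ (by lia),
        fun i hi => hX _ (by lia), ?_, ?_, fun i => hd (i + 1)⟩⟩
    · rintro ⟨x, hx⟩
      obtain ⟨y, rfl⟩ := (hdε x).1 hx
      exact ⟨y, rfl⟩
    · intro x
      rw [← hd 0 x]
      exact Subtype.ext_iff

theorem GDimLE.hasTotallyReflexiveResolution {n : ℕ} (h : GDimLE R n A) :
    HasTotallyReflexiveResolution R n A := by
  induction n generalizing A with
  | zero =>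
    refine ⟨fun i => match i with
        | 0 => ModuleCat.of R A
        | _ + 1 => ModuleCat.of R PUnit, fun _ => 0, LinearMap.id, ?_, ?_, fun x => ⟨x, rfl⟩,
      ?_, ?_⟩
    · rintro (_ | i) hi
      · exact h
      · lia
    · rintro (_ | i) hi
      · lia
      · exact inferInstanceAs (Subsingleton PUnit)
    · exact fun x => ⟨fun hx => ⟨0, hx.symm⟩, fun ⟨_, hx⟩ => hx.symm⟩
    · exact fun i x => ⟨fun _ => ⟨0, rfl⟩, fun _ => rfl⟩
  | succ n ih =>
    obtain ⟨Z, T, f, g, hfg, hT, hZ⟩ := h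
    obtain ⟨X, d, ε, hX, hX0, hε, hdε, hd⟩ := ih hZ
    refine ⟨fun i => match i with
        | 0 => T
        | i + 1 => X i, fun i => match i with
        | 0 => f ∘ₗ ε
        | i + 1 => d i, g, ?_, ?_, hfg.surjective, ?_, ?_⟩
    · rintro (_ | i) hi
      · exact hT
      · exact hX i (by lia)
    · rintro (_ | i) hi
      · lia
      · exact hX0 i (by lia)
    · intro x
      rw [hfg.exact x]
      exact ⟨fun ⟨z, hz⟩ => (hε z).imp fun y hy => (congrArg f hy).trans hz,
        fun ⟨y, hy⟩ => ⟨ε y, hy⟩⟩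
    · rintro (_ | i)
      · intro x
        rw [← hdε x]
        exact map_eq_zero_iff f hfg.injective
      · exact hd i

theorem gorensteinDim_lt_top_iff : gorensteinDim R A < ⊤ ↔ FiniteGDim R A := by
  rw [gorensteinDim]
  split_ifs with hA
  · exact iff_of_true (WithBot.bot_lt_coe _) ⟨0, IsTotallyReflexive.of_subsingleton A⟩
  · have hiff : FiniteGDim R A ↔ ∃ n, HasTotallyReflexiveResolution R n A :=
      exists_congr fun n => ⟨GDimLE.hasTotallyReflexiveResolution, HasTotallyReflexiveResolution.gDimLE⟩
    rw [hiff, ← WithBot.coe_top, WithBot.coe_lt_coe]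
    simp [iInf_lt_iff]

end

/-! ### Stable isomorphism and syzygies -/

/-- `A` and `B` become isomorphic after adding finitely generated projective modules. -/
def StablyIso (R : Type u) [CommRing R] (A B : Type u) [AddCommGroup A] [AddCommGroup B]
    [Module R A] [Module R B] : Prop :=
  ∃ P Q : ModuleCat.{u} R, (Module.Finite R P ∧ Module.Projective R P) ∧
    (Module.Finite R Q ∧ Module.Projective R Q) ∧ Nonempty ((A × P) ≃ₗ[R] (B × Q))

namespace StablyIso

variable {R : Type u} [CommRing R] {A B C D P Q : Type u} [AddCommGroup A] [AddCommGroup B]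
  [AddCommGroup C] [AddCommGroup D] [AddCommGroup P] [AddCommGroup Q] [Module R A] [Module R B]
  [Module R C] [Module R D] [Module R P] [Module R Q]

theorem of_prod_equiv [Module.Finite R P] [Module.Projective R P] [Module.Finite R Q]
    [Module.Projective R Q] (e : (A × P) ≃ₗ[R] (B × Q)) : StablyIso R A B :=
  ⟨ModuleCat.of R P, ModuleCat.of R Q, ⟨‹_›, ‹_›⟩, ⟨‹_›, ‹_›⟩, ⟨e⟩⟩

theorem of_equiv (e : A ≃ₗ[R] B) : StablyIso R A B :=
  of_prod_equiv (e.prodCongr (.refl R PUnit.{u + 1}))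

theorem symm (h : StablyIso R A B) : StablyIso R B A := by
  obtain ⟨P, Q, hP, hQ, ⟨e⟩⟩ := h
  exact ⟨Q, P, hQ, hP, ⟨e.symm⟩⟩

theorem trans (h : StablyIso R A B) (h' : StablyIso R B C) : StablyIso R A C := by
  obtain ⟨P, Q, ⟨_, _⟩, ⟨_, _⟩, ⟨e⟩⟩ := h
  obtain ⟨P', Q', ⟨_, _⟩, ⟨_, _⟩, ⟨e'⟩⟩ := h'
  refine of_prod_equiv (P := P × P') (Q := Q' × Q) ?_
  exact (LinearEquiv.prodAssoc R A P P').symm ≪≫ₗ e.prodCongr (.refl R P') ≪≫ₗ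
    LinearEquiv.prodAssoc R B Q P' ≪≫ₗ (LinearEquiv.refl R B).prodCongr (.prodComm R Q P') ≪≫ₗ
    (LinearEquiv.prodAssoc R B P' Q).symm ≪≫ₗ e'.prodCongr (.refl R Q) ≪≫ₗ
    LinearEquiv.prodAssoc R C Q' Q

/-- Schanuel's lemma: kernels of projective covers of stably isomorphic modules are stably
isomorphic. -/
theorem schanuel {i : A →ₗ[R] P} {p : P →ₗ[R] C} (h : IsShortExact i p) [Module.Finite R P]
    [Module.Projective R P] {j : B →ₗ[R] Q} {q : Q →ₗ[R] D} (h' : IsShortExact j q)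
    [Module.Finite R Q] [Module.Projective R Q] (hCD : StablyIso R C D) : StablyIso R A B := by
  obtain ⟨F, G, ⟨_, _⟩, ⟨_, _⟩, ⟨e⟩⟩ := hCD
  have h₁ := ((h.prodMap (.zero_equiv (D := PUnit.{u + 1}) (.refl R F))).comp_left
    LinearEquiv.prodUnique.symm).comp_right e
  have h₂ := (h'.prodMap (.zero_equiv (D := PUnit.{u + 1}) (.refl R G))).comp_left
    LinearEquiv.prodUnique.symm
  obtain ⟨X, f₁, g₁, p₁, q₁, h₃, h₄⟩ := h₁.exists_pullback h₂
  obtain ⟨e₁⟩ := h₃.exists_equiv_prod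
  obtain ⟨e₂⟩ := h₄.exists_equiv_prod
  exact of_prod_equiv (e₁.symm ≪≫ₗ e₂)

end StablyIso

section syzygy

variable (R : Type u) [CommRing R]

theorem syzygy_add (M : ModuleCat.{u} R) (m n : ℕ) :
    syzygy R (m + n) M = syzygy R m (syzygy R n M) := by
  induction m with
  | zero => rw [Nat.zero_add, syzygy]
  | succ m ih => rw [Nat.succ_add, syzygy, ih, syzygy]

theorem isShortExact_minimalCover (M : Type u) [AddCommGroup M] [Module R M] :
    IsShortExact (A := LinearMap.ker (minimalCover R M))
      (LinearMap.ker (minimalCover R M)).subtype (minimalCover R M) := by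
  refine .of_surjective ?_
  rw [← LinearMap.range_eq_top, minimalCover, Finsupp.range_linearCombination, Subtype.range_coe_subtype]
  exact Submodule.span_generators _

/-- The free module in the minimal cover is finitely generated. -/
theorem finite_minimalCover (M : Type u) [AddCommGroup M] [Module R M] [hM : Module.Finite R M] :
    Module.Finite R ((⊤ : Submodule R M).generators →₀ R) := by
  have : Finite (⊤ : Submodule R M).generators := hM.fg_top.finite_generators
  infer_instance

variable [IsNoetherianRing R]

theorem finite_syzygy (M : ModuleCat.{u} R) [Module.Finite R M] (n : ℕ) :
    Module.Finite R (syzygy R n M) := by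
  induction n with
  | zero => assumption
  | succ n ih =>
    have := finite_minimalCover R (syzygy R n M)
    exact (isShortExact_minimalCover R (syzygy R n M)).finite_left

variable {R} in
theorem StablyIso.syzygy {M N : ModuleCat.{u} R} [Module.Finite R M] [Module.Finite R N]
    (h : StablyIso R M N) (n : ℕ) : StablyIso R (syzygy R n M) (syzygy R n N) := by
  induction n with
  | zero => exact h
  | succ n ih =>
    have := finite_syzygy R M n
    have := finite_syzygy R N n
    have := finite_minimalCover R (_root_.syzygy R n M)
    have := finite_minimalCover R (_root_.syzygy R n N)
    exact .schanuel (isShortExact_minimalCover R _) (isShortExact_minimalCover R _) ih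

theorem stablyIso_pi_syzygy (M : ModuleCat.{u} R) [Module.Finite R M] (c n : ℕ) :
    StablyIso R (Fin c → syzygy R n M) (syzygy R n (ModuleCat.of R (Fin c → M))) := by
  induction n with
  | zero => exact .of_equiv (.refl R _)
  | succ n ih =>
    have := finite_syzygy R M n
    have := finite_syzygy R (ModuleCat.of R (Fin c → M)) n
    have := finite_minimalCover R (syzygy R n M)
    have := finite_minimalCover R (syzygy R n (ModuleCat.of R (Fin c → M)))
    exact .schanuel ((isShortExact_minimalCover R _).piMap (Fin c))
      (isShortExact_minimalCover R _) ih

end syzygy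

/-! ### Extensions whose middle term has finite Gorenstein dimension -/

/-- There is a short exact sequence `0 → A → Y → C → 0` in which `Y` has finite Gorenstein
dimension. -/
def HasFiniteGDimExtension (R : Type u) [CommRing R] (A C : Type u) [AddCommGroup A]
    [AddCommGroup C] [Module R A] [Module R C] : Prop :=
  ∃ (Y : ModuleCat.{u} R) (f : A →ₗ[R] Y) (g : Y →ₗ[R] C), IsShortExact f g ∧ FiniteGDim R Y

namespace HasFiniteGDimExtension

variable {R : Type u} [CommRing R] [IsNoetherianRing R] {A B C : Type u} [AddCommGroup A]
  [AddCommGroup B] [AddCommGroup C] [Module R A] [Module R B] [Module R C]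

theorem congr_right (h : HasFiniteGDimExtension R A B) (hBC : StablyIso R B C) :
    HasFiniteGDimExtension R A C := by
  obtain ⟨Y, f, g, h, hY⟩ := h
  obtain ⟨P, Q, ⟨_, _⟩, ⟨_, _⟩, ⟨e⟩⟩ := hBC
  have h₁ := ((h.prodMap (.zero_equiv (D := PUnit.{u + 1}) (.refl R P))).comp_left
    LinearEquiv.prodUnique.symm).comp_right e
  obtain ⟨X, i, s, j, h₂, h₃⟩ := h₁.exists_ker_comp .inl_snd
  exact ⟨X, i, s, h₂, .left h₃ (hY.prod (.of_projective P)) (.of_projective Q)⟩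

theorem congr_left (h : HasFiniteGDimExtension R A C) (hAB : StablyIso R A B) :
    HasFiniteGDimExtension R B C := by
  obtain ⟨Y, f, g, h, hY⟩ := h
  obtain ⟨P, Q, ⟨_, _⟩, ⟨_, _⟩, ⟨e⟩⟩ := hAB
  have h₁ := ((h.prodMap (.equiv_zero (D := PUnit.{u + 1}) (.refl R P))).comp_right
    LinearEquiv.prodUnique).comp_left e.symm
  obtain ⟨X, i, s, t, h₂, h₃⟩ := h₁.exists_coker_comp .inr_fst
  exact ⟨X, i, s, h₂, .right h₃ (.of_projective Q) (hY.prod (.of_projective P))⟩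

/-- Finite direct sums of copies. -/
theorem pi (h : HasFiniteGDimExtension R A C) (c : ℕ) :
    HasFiniteGDimExtension R (Fin c → A) (Fin c → C) := by
  obtain ⟨Y, f, g, h, hY⟩ := h
  exact ⟨ModuleCat.of R (Fin c → Y), _, _, h.piMap (Fin c), hY.pi c⟩

theorem syzygy {A C : ModuleCat.{u} R} [Module.Finite R A] [Module.Finite R C]
    (h : HasFiniteGDimExtension R A C) (n : ℕ) :
    HasFiniteGDimExtension R (syzygy R n A) (syzygy R n C) := by
  induction n with
  | zero => exact h
  | succ n ih =>
    obtain ⟨Y, f, g, h, hY⟩ := ih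
    have := finite_syzygy R A n
    have := finite_syzygy R C n
    have := finite_minimalCover R (_root_.syzygy R n A)
    have := finite_minimalCover R (_root_.syzygy R n C)
    obtain ⟨Z, f', g', k, r, h₁, h₂⟩ := h.exists_horseshoe
      (isShortExact_minimalCover R (_root_.syzygy R n A))
      (isShortExact_minimalCover R (_root_.syzygy R n C))
    exact ⟨Z, f', g', h₁, .left h₂ (.of_projective _) hY⟩

/-- Splicing: an extension of `B` by `A` and an extension of `C` by the first syzygy of `B` yield
an extension of `C` by `A`. -/
theorem splice {B : ModuleCat.{u} R} [Module.Finite R B] (h : HasFiniteGDimExtension R A B)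
    (h' : HasFiniteGDimExtension R (_root_.syzygy R 1 B) C) : HasFiniteGDimExtension R A C := by
  obtain ⟨Y, f, g, h, hY⟩ := h
  obtain ⟨Z, i, p, h', hZ⟩ := h'
  have := finite_minimalCover R B
  -- Pulling back along the cover of `B` embeds its syzygy into a module stably isomorphic to `A`,
  -- with cokernel `Y`; pushing out along this embedding combines the two extensions.
  obtain ⟨P, f₁, g₁, p₁, q₁, h₁, h₂⟩ := h.exists_pullback (isShortExact_minimalCover R B)
  obtain ⟨e⟩ := h₁.exists_equiv_prod
  obtain ⟨Q, f₂, g₂, p₂, q₂, h₃, h₄⟩ := IsShortExact.exists_pushout h' h₂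
  have hPA : StablyIso R P A := .of_prod_equiv (P := PUnit.{u + 1}) (LinearEquiv.prodUnique ≪≫ₗ e)
  exact congr_left ⟨Q, f₂, g₂, h₃, .middle h₄ hZ hY⟩ hPA

end HasFiniteGDimExtension

/-- The inductive step: a sequence with parameters `(a, b, n)` yields one with parameters
`(a², b², 2n + 1)`. -/
theorem hasFiniteGDimExtension_double {R : Type u} [CommRing R] [IsNoetherianRing R] (M : Type u)
    [AddCommGroup M] [Module R M] [Module.Finite R M] {a b n : ℕ}
    (h : HasFiniteGDimExtension R (Fin a → M) (syzygy R n (ModuleCat.of R (Fin b → M)))) :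
    HasFiniteGDimExtension R (Fin (a * a) → M)
      (syzygy R (2 * n + 1) (ModuleCat.of R (Fin (b * b) → M))) := by
  have := finite_syzygy R (ModuleCat.of R (Fin b → M)) n
  let S := syzygy R n (ModuleCat.of R (Fin b → M))
  let curry (k l : ℕ) : (Fin k → Fin l → M) ≃ₗ[R] (Fin (k * l) → M) :=
    (LinearEquiv.curry R M (Fin k) (Fin l)).symm ≪≫ₗ
      LinearEquiv.funCongrLeft R M finProdFinEquiv.symm
  have h₁ : HasFiniteGDimExtension R (Fin a → Fin a → M) (ModuleCat.of R (Fin a → S)) := h.pi a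
  have h₂ : HasFiniteGDimExtension R (ModuleCat.of R (Fin b → Fin a → M))
    (ModuleCat.of R (Fin b → S)) := h.pi b
  have hL : StablyIso R (syzygy R (n + 1) (ModuleCat.of R (Fin b → Fin a → M)))
      (syzygy R 1 (ModuleCat.of R (Fin a → S))) := by
    have e : (Fin b → Fin a → M) ≃ₗ[R] (Fin a → Fin b → M) :=
      curry b a ≪≫ₗ LinearEquiv.funCongrLeft R M (finCongr (mul_comm a b)) ≪≫ₗ (curry a b).symm
    have h₃ := (StablyIso.of_equiv (A := ModuleCat.of R (Fin b → Fin a → M))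
      (B := ModuleCat.of R (Fin a → Fin b → M)) e).syzygy n
    have h₄ : StablyIso R (syzygy R n (ModuleCat.of R (Fin b → Fin a → M)))
        (ModuleCat.of R (Fin a → S)) :=
      h₃.trans (stablyIso_pi_syzygy R (ModuleCat.of R (Fin b → M)) a n).symm
    have := finite_syzygy R (ModuleCat.of R (Fin b → Fin a → M)) n
    rw [add_comm, syzygy_add]
    exact h₄.syzygy 1
  have hN : StablyIso R (syzygy R (n + 1) (ModuleCat.of R (Fin b → S)))
      (syzygy R (2 * n + 1) (ModuleCat.of R (Fin (b * b) → M))) := by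
    have h₃ : StablyIso R (ModuleCat.of R (Fin b → S))
        (syzygy R n (ModuleCat.of R (Fin (b * b) → M))) :=
      (stablyIso_pi_syzygy R (ModuleCat.of R (Fin b → M)) b n).trans
        ((StablyIso.of_equiv (A := ModuleCat.of R (Fin b → Fin b → M))
          (B := ModuleCat.of R (Fin (b * b) → M)) (curry b b)).syzygy n)
    have := finite_syzygy R (ModuleCat.of R (Fin (b * b) → M)) n
    rw [two_mul, add_right_comm, syzygy_add R (ModuleCat.of R (Fin (b * b) → M))]
    exact h₃.syzygy (n + 1)
  exact (h₁.splice (((h₂.syzygy (n + 1)).congr_left hL).congr_right hN)).congr_left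
    (.of_equiv (curry a a))

theorem proposition2p7 (R : Type u) [CommRing R] [IsLocalRing R] [IsNoetherianRing R]
    (M : Type u) [AddCommGroup M] [Module R M] [Module.Finite R M]
    (K : Type u) [AddCommGroup K] [Module R K] [Module.Finite R K]
    (a b n : ℕ) (ha : 1 ≤ a) (hb : 1 ≤ b)
    (f : (Fin a → M) →ₗ[R] K) (g : K →ₗ[R] syzygy R n (ModuleCat.of R (Fin b → M)))
    (hf : Function.Injective f) (hfg : Function.Exact f g) (hg : Function.Surjective g)
    (hK : gorensteinDim R K < ⊤)
    (i : ℕ) (hi : 1 ≤ i) :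
    ∃ (Y : Type u) (_ : AddCommGroup Y) (_ : Module R Y)
      (f' : (Fin (a ^ 2 ^ i) → M) →ₗ[R] Y)
      (g' : Y →ₗ[R] syzygy R (2 ^ i * (n + 1) - 1) (ModuleCat.of R (Fin (b ^ 2 ^ i) → M))),
      Module.Finite R Y ∧ Function.Injective f' ∧ Function.Exact f' g' ∧ Function.Surjective g' ∧
        gorensteinDim R Y < ⊤ := by
  have key (j : ℕ) : HasFiniteGDimExtension R (Fin (a ^ 2 ^ j) → M)
      (syzygy R (2 ^ j * (n + 1) - 1) (ModuleCat.of R (Fin (b ^ 2 ^ j) → M))) := by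
    induction j with
    | zero =>
      rw [pow_zero, pow_one, pow_one, one_mul, Nat.add_sub_cancel]
      exact ⟨ModuleCat.of R K, f, g, ⟨hf, hfg, hg⟩, gorensteinDim_lt_top_iff.1 hK⟩
    | succ j ih =>
      have hr : 2 ^ (j + 1) * (n + 1) - 1 = 2 * (2 ^ j * (n + 1) - 1) + 1 := by
        have : 0 < 2 ^ j * (n + 1) := by positivity
        rw [pow_succ, mul_comm _ 2, mul_assoc]
        lia
      have hsq (x : ℕ) : x ^ 2 ^ (j + 1) = x ^ 2 ^ j * x ^ 2 ^ j := by
        rw [← pow_add, pow_succ, mul_two]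
      rw [hr, hsq, hsq]
      exact hasFiniteGDimExtension_double M ih
  obtain ⟨Y, f', g', h, hY⟩ := key i
  exact ⟨Y, inferInstance, inferInstance, f', g', hY.finite, h.injective, h.exact, h.surjective,
    gorensteinDim_lt_top_iff.2 hY⟩
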